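/- Let $d\ge 1$ and let $M_d$ be the space of complex $d\times d$ matrices, with trace norm $\|A\|_1=\operatorname{tr}\sqrt{A^*A}$. For a completely positive trace-preserving (CPTP) linear map $T:M_d\to M_d$ put $$\kappa_{\rm tr}(T):=\sup\Big\{\frac{\|T(X)\|_1}{\|X\|_1}\;:\;X=X^*,\ \operatorname{tr}X=0,\ X\neq 0\Big\}$$ (with value $0$ if there is no such $X$, i.e. if $d=1$). Let $(\Omega,\mathcal F,\mathbb P)$ be a probability space, let $\theta:\Omega\to\Omega$ be a measure-preserving bijection with measurable inverse (not necessarily ergodic), and let $\omega\mapsto\Phi_\omega$ be a measurable map from $\Omega$ to the linear maps on $M_d$ such that every $\Phi_\omega$ is CPTP. For integers $s<t$ write $$\Phi_{\omega;t:s}:=\Phi_{\theta^{t-1}\omega}\circ\Phi_{\theta^{t-2}\omega}\circ\cdots\circ\Phi_{\theta^{s}\omega},\qquad \kappa_{\omega;t:s}:=\kappa_{\rm tr}(\Phi_{\omega;t:s}).$$ Then, with the convention $\log 0=-\infty$, the limit $$\lambda_{\rm tr}(\omega):=\lim_{n\to\infty}\frac1n\log\kappa_{\omega;n:0}$$ exists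 in $[-\infty,0]$ for $\mathbb P$-a.e. $\omega$, and the following three conditions are equivalent: 1. $\lambda_{\rm tr}(\omega)<0$ for $\mathbb P$-a.e. $\omega$; 2. $\kappa_{\omega;n:0}\to 0$ as $n\to\infty$ for $\mathbb P$-a.e. $\omega$; 3. $\kappa_{\omega;0:-n}\to 0$ as $n\to\infty$ for $\mathbb P$-a.e. $\omega$. -/

import Mathlib

open Filter Topology MeasureTheory
open scoped ComplexOrder

/-- The space `M_d` of `d × d` complex matrices. -/
abbrev MatC (d : ℕ) : Type := Matrix (Fin d) (Fin d) ℂ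

/-- Linear maps on `M_d` (superoperators). -/
abbrev SuperOp (d : ℕ) : Type := MatC d →ₗ[ℂ] MatC d

/-- The trace norm `‖A‖₁ = tr √(Aᴴ A)`, i.e. the sum of the singular values of `A`
(the square roots of the eigenvalues of `Aᴴ A`, with multiplicity). -/
noncomputable def traceNorm {d : ℕ} (A : MatC d) : ℝ :=
  ∑ i, Real.sqrt ((Matrix.isHermitian_conjTranspose_mul_self A).eigenvalues i)

/-- The amplification `id_k ⊗ T`, acting on `k × k` block matrices with blocks in `M_d`
by applying `T` to each block. -/
def amplification {d : ℕ} (T : SuperOp d) (k : ℕ)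
    (M : Matrix (Fin k × Fin d) (Fin k × Fin d) ℂ) :
    Matrix (Fin k × Fin d) (Fin k × Fin d) ℂ :=
  Matrix.of fun p q => T (Matrix.of fun a b => M (p.1, a) (q.1, b)) p.2 q.2

/-- Completely positive and trace-preserving maps (quantum channels) on `M_d`. -/
structure IsCPTP {d : ℕ} (T : SuperOp d) : Prop where
  completelyPositive : ∀ (k : ℕ) (M : Matrix (Fin k × Fin d) (Fin k × Fin d) ℂ),
    M.PosSemidef → (amplification T k M).PosSemidef
  tracePreserving : ∀ X : MatC d, (T X).trace = X.trace

/-- The centered trace-Dobrushin coefficient: the supremum of `‖T X‖₁ / ‖X‖₁` over nonzero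
self-adjoint trace-zero matrices `X`. (For `d ≤ 1` there is no such `X` and the value is `0`,
the norm of the operator on the zero space.) -/
noncomputable def kappaTr {d : ℕ} (T : SuperOp d) : ℝ :=
  sSup {r : ℝ | ∃ X : MatC d, X.IsHermitian ∧ X.trace = 0 ∧ X ≠ 0 ∧
    r = traceNorm (T X) / traceNorm X}

/-- Measurability of `ω ↦ Φ_ω` as a map into the finite-dimensional space of superoperators,
expressed through its coordinates. -/
def MeasurableSuperOpFamily {Ω : Type*} [MeasurableSpace Ω] {d : ℕ} (Φ : Ω → SuperOp d) : Prop :=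
  ∀ (X : MatC d) (i j : Fin d), Measurable fun ω => Φ ω X i j

section Cocycle

variable {Ω : Type*} [MeasurableSpace Ω] {d : ℕ}

/-- The integer iterate `θ^j ω`, `j ∈ ℤ`. -/
def thetaPow (θ : Ω ≃ᵐ Ω) (j : ℤ) (ω : Ω) : Ω :=
  ((θ.toEquiv : Equiv.Perm Ω) ^ j) ω

/-- `blockProduct θ Φ ω s n = Φ_{θ^{s+n-1} ω} ∘ ⋯ ∘ Φ_{θ^s ω}` (`n` factors). -/
def blockProduct (θ : Ω ≃ᵐ Ω) (Φ : Ω → SuperOp d) (ω : Ω) (s : ℤ) : ℕ → SuperOp d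
  | 0 => LinearMap.id
  | n + 1 => Φ (thetaPow θ (s + n) ω) ∘ₗ blockProduct θ Φ ω s n

/-- The chronological product `Φ_{ω;t:s} = Φ_{θ^{t-1} ω} ∘ ⋯ ∘ Φ_{θ^s ω}` for integers `s ≤ t`,
with `Φ_{ω;s:s} = id`. -/
def chronProduct (θ : Ω ≃ᵐ Ω) (Φ : Ω → SuperOp d) (ω : Ω) (t s : ℤ) : SuperOp d :=
  blockProduct θ Φ ω s (t - s).toNat

/-- The coefficient `κ_{ω;t:s}` of the chronological product, for integers `s ≤ t`. -/
noncomputable def kappaProduct (θ : Ω ≃ᵐ Ω) (Φ : Ω → SuperOp d) (ω : Ω) (t s : ℤ) : ℝ :=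
  kappaTr (chronProduct θ Φ ω t s)

/-- The normalized logarithm `(1/n) log κ_{ω;n:0} ∈ [-∞, ∞]`, with `log 0 = -∞`. -/
noncomputable def normalizedLogKappa (θ : Ω ≃ᵐ Ω) (Φ : Ω → SuperOp d) (ω : Ω) (n : ℕ) : EReal :=
  ENNReal.log (ENNReal.ofReal (kappaProduct θ Φ ω n 0)) / (n : EReal)

/-- The trace-Dobrushin Lyapunov exponent `λ_tr(ω) = lim_n (1/n) log κ_{ω;n:0}`. It is given by
the upper limit, which makes it defined for every `ω` and equals the limit where that exists. -/
noncomputable def lambdaTr (θ : Ω ≃ᵐ Ω) (Φ : Ω → SuperOp d) (ω : Ω) : EReal :=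
  limsup (normalizedLogKappa θ Φ ω) atTop

end Cocycle

/-! ### Trace norm: functional calculus and the bound for differences of positive matrices. -/

section TraceNorm

open scoped MatrixOrder Matrix.Norms.L2Operator

variable {d : ℕ}

/-! A positive trace-preserving map contracts the trace norm on Hermitian matrices, so `κ_n(ω) =
κ_{ω;n:0}` is a submultiplicative cocycle over `θ` with values in `[0,1]`. What remains is ergodic
theory of such cocycles.

Limit: `ae_eventually_le_exp` upgrades decay along infinitely many `n` to decay for all large `n` at
any slower rate, so liminf and limsup agree. Orbits are cut into blocks of good decay; the maximal
ergodic inequality bounds the frequency of points where no short good block starts.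

Equivalences: (1) gives (2) at once. Conversely, on the set where `κ_n` decays subexponentially,
submultiplicativity sends the averages of `1 - κ_n` along `θ^n` to `0`; invariance of the measure
then forces `κ_n = 1` there (`ae_eq_one_of_subexponential`), so under (2) this set is null. For (2)
and (3), the forward and backward coefficients have equal integrals for each `n` and both decrease
in `n`, so each tends to `0` a.e. exactly when its integrals do. Ergodicity never enters. -/

theorem trace_cfc_of_isHermitian {A : MatC d} (hA : A.IsHermitian) (f : ℝ → ℝ) :
    (cfc f A).trace = ((∑ i, f (hA.eigenvalues i) : ℝ) : ℂ) := by
  rw [hA.cfc_eq, Matrix.IsHermitian.cfc, Unitary.conjStarAlgAut_apply, Matrix.trace_mul_cycle,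
    Unitary.coe_star_mul_self, one_mul, Matrix.trace_diagonal]
  simp

/-- Rewriting through `CFC.abs` makes continuity, definiteness and the decomposition into positive
and negative parts available. -/
theorem traceNorm_eq_re_trace_abs (A : MatC d) : traceNorm A = (CFC.abs A).trace.re := by
  have h := Matrix.isHermitian_conjTranspose_mul_self A
  have h0 : (0 : MatC d) ≤ star A * A := star_mul_self_nonneg A
  rw [CFC.abs, CFC.sqrt_eq_real_sqrt _ h0, cfcₙ_eq_cfc]
  rw [Matrix.star_eq_conjTranspose, trace_cfc_of_isHermitian h, Complex.ofReal_re, traceNorm]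

theorem continuous_traceNorm : Continuous (traceNorm : MatC d → ℝ) := by
  have h : (traceNorm : MatC d → ℝ) = fun A => (CFC.abs A).trace.re :=
    funext traceNorm_eq_re_trace_abs
  rw [h]
  exact Complex.continuous_re.comp (Continuous.matrix_trace CFC.continuous_abs)

theorem traceNorm_nonneg (A : MatC d) : 0 ≤ traceNorm A :=
  Finset.sum_nonneg fun _ _ => Real.sqrt_nonneg _

theorem traceNorm_zero : traceNorm (0 : MatC d) = 0 := by
  rw [traceNorm_eq_re_trace_abs]; simp

theorem traceNorm_pos {A : MatC d} (hA : A ≠ 0) : 0 < traceNorm A := by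
  refine (traceNorm_nonneg A).lt_of_ne' fun h => hA ?_
  rw [← CFC.abs_eq_zero_iff]
  have hpsd : (CFC.abs A).PosSemidef := Matrix.nonneg_iff_posSemidef.mp (CFC.abs_nonneg A)
  rw [← hpsd.trace_eq_zero_iff]
  have him := hpsd.trace_nonneg
  rw [traceNorm_eq_re_trace_abs] at h
  rw [Complex.le_def] at him
  exact Complex.ext h him.2.symm

theorem traceNorm_eq_re_trace_posPart_add_negPart {A : MatC d} (hA : A.IsHermitian) :
    traceNorm A = (A⁺).trace.re + (A⁻).trace.re := by
  rw [traceNorm_eq_re_trace_abs, ← CFC.posPart_add_negPart A hA, Matrix.trace_add, Complex.add_re]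

theorem traceNorm_eq_sum_abs_eigenvalues {A : MatC d} (hA : A.IsHermitian) :
    traceNorm A = ∑ i, |hA.eigenvalues i| := by
  rw [traceNorm_eq_re_trace_abs, CFC.abs_eq_cfc_norm A hA, trace_cfc_of_isHermitian hA]
  simp

/-- In an eigenbasis of `P - N`, each eigenvalue is a difference of nonnegative diagonal entries of
`P` and `N`, so its modulus is at most their sum. -/
theorem traceNorm_sub_le {P N : MatC d} (hP : P.PosSemidef) (hN : N.PosSemidef) :
    traceNorm (P - N) ≤ P.trace.re + N.trace.re := by
  have hA : (P - N).IsHermitian := hP.1.sub hN.1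
  let U : MatC d := (hA.eigenvectorUnitary : MatC d)
  have hUU : U * star U = 1 := Unitary.coe_mul_star_self _
  have key : star U * (P - N) * U
      = Matrix.diagonal (RCLike.ofReal ∘ hA.eigenvalues) := by
    have := hA.conjStarAlgAut_star_eigenvectorUnitary
    rw [Unitary.conjStarAlgAut_apply] at this
    simpa using this
  have hP' : (star U * P * U).PosSemidef := hP.conjTranspose_mul_mul_same U
  have hN' : (star U * N * U).PosSemidef := hN.conjTranspose_mul_mul_same U
  have hPt : (star U * P * U).trace = P.trace := by
    rw [Matrix.trace_mul_cycle, hUU, one_mul]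
  have hNt : (star U * N * U).trace = N.trace := by
    rw [Matrix.trace_mul_cycle, hUU, one_mul]
  rw [traceNorm_eq_sum_abs_eigenvalues hA, ← hPt, ← hNt, Matrix.trace, Matrix.trace,
    Complex.re_sum, Complex.re_sum, ← Finset.sum_add_distrib]
  refine Finset.sum_le_sum fun i _ => ?_
  have h1 : hA.eigenvalues i = ((star U * P * U) i i).re - ((star U * N * U) i i).re := by
    have := congrArg (fun M : MatC d => (M i i).re) key
    simp only [mul_sub, sub_mul, Matrix.sub_apply, Complex.sub_re] at this
    rw [this]; simp
  have h2 := (Complex.le_def.mp (hP'.diag_nonneg (i := i))).1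
  have h3 := (Complex.le_def.mp (hN'.diag_nonneg (i := i))).1
  simp only [Complex.zero_re, Matrix.diag_apply] at h2 h3 ⊢
  rw [h1, abs_le]
  constructor <;> linarith

end TraceNorm

/-! ### Contraction and submultiplicativity of the Dobrushin coefficient. -/

section CPTP

open scoped MatrixOrder Matrix.Norms.L2Operator

variable {d : ℕ}

theorem IsCPTP.id : IsCPTP (LinearMap.id : SuperOp d) :=
  ⟨fun _ _ hM => hM, fun _ => rfl⟩

theorem IsCPTP.comp {S T : SuperOp d} (hS : IsCPTP S) (hT : IsCPTP T) : IsCPTP (S ∘ₗ T) :=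
  ⟨fun k M hM => hS.completelyPositive k _ (hT.completelyPositive k M hM),
    fun X => (hS.tracePreserving _).trans (hT.tracePreserving X)⟩

theorem IsCPTP.posSemidef {T : SuperOp d} (hT : IsCPTP T) {X : MatC d} (hX : X.PosSemidef) :
    (T X).PosSemidef :=
  (hT.completelyPositive 1 _ (hX.submatrix Prod.snd)).submatrix (fun i => ((0 : Fin 1), i))

theorem IsCPTP.isHermitian {T : SuperOp d} (hT : IsCPTP T) {X : MatC d} (hX : X.IsHermitian) :
    (T X).IsHermitian := by
  have h : X = X⁺ - X⁻ := (CFC.posPart_sub_negPart X hX).symm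
  rw [h, map_sub]
  exact (hT.posSemidef (Matrix.nonneg_iff_posSemidef.mp (CFC.posPart_nonneg X))).1.sub
    (hT.posSemidef (Matrix.nonneg_iff_posSemidef.mp (CFC.negPart_nonneg X))).1

theorem IsCPTP.traceNorm_apply_le {T : SuperOp d} (hT : IsCPTP T) {X : MatC d}
    (hX : X.IsHermitian) : traceNorm (T X) ≤ traceNorm X := by
  have h : X = X⁺ - X⁻ := (CFC.posPart_sub_negPart X hX).symm
  have hP := hT.posSemidef (Matrix.nonneg_iff_posSemidef.mp (CFC.posPart_nonneg X))
  have hN := hT.posSemidef (Matrix.nonneg_iff_posSemidef.mp (CFC.negPart_nonneg X))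
  calc traceNorm (T X) = traceNorm (T X⁺ - T X⁻) := by rw [← map_sub, ← h]
    _ ≤ (T X⁺).trace.re + (T X⁻).trace.re := traceNorm_sub_le hP hN
    _ = traceNorm X := by
      rw [hT.tracePreserving, hT.tracePreserving, traceNorm_eq_re_trace_posPart_add_negPart hX]

theorem kappaTr_nonneg (T : SuperOp d) : 0 ≤ kappaTr T := by
  refine Real.sSup_nonneg ?_
  rintro r ⟨X, -, -, -, rfl⟩
  exact div_nonneg (traceNorm_nonneg _) (traceNorm_nonneg _)

theorem IsCPTP.ratio_le_one {T : SuperOp d} (hT : IsCPTP T) {X : MatC d}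
    (hX : X.IsHermitian) : traceNorm (T X) / traceNorm X ≤ 1 :=
  div_le_one_of_le₀ (hT.traceNorm_apply_le hX) (traceNorm_nonneg X)

theorem IsCPTP.kappaTr_le_one {T : SuperOp d} (hT : IsCPTP T) : kappaTr T ≤ 1 := by
  refine Real.sSup_le ?_ zero_le_one
  rintro r ⟨X, hX, -, -, rfl⟩
  exact hT.ratio_le_one hX

theorem IsCPTP.traceNorm_apply_le_kappaTr_mul {T : SuperOp d} (hT : IsCPTP T) {X : MatC d}
    (hX : X.IsHermitian) (hX0 : X.trace = 0) : traceNorm (T X) ≤ kappaTr T * traceNorm X := by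
  rcases eq_or_ne X 0 with rfl | hne
  · simp [traceNorm_zero]
  · rw [← div_le_iff₀ (traceNorm_pos hne)]
    -- Contraction bounds the ratios by `1`; without a bound the real `sSup` would take a default
    -- value.
    refine le_csSup ⟨1, ?_⟩ ⟨X, hX, hX0, hne, rfl⟩
    rintro r ⟨Y, hY, -, -, rfl⟩
    exact hT.ratio_le_one hY

theorem IsCPTP.kappaTr_comp_le {S T : SuperOp d} (hS : IsCPTP S) (hT : IsCPTP T) :
    kappaTr (S ∘ₗ T) ≤ kappaTr S * kappaTr T := by
  refine Real.sSup_le ?_ (mul_nonneg (kappaTr_nonneg S) (kappaTr_nonneg T))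
  rintro r ⟨X, hX, hX0, hne, rfl⟩
  rw [div_le_iff₀ (traceNorm_pos hne), LinearMap.comp_apply]
  calc traceNorm (S (T X)) ≤ kappaTr S * traceNorm (T X) :=
        hS.traceNorm_apply_le_kappaTr_mul (hT.isHermitian hX) (by rw [hT.tracePreserving, hX0])
    _ ≤ kappaTr S * (kappaTr T * traceNorm X) :=
        mul_le_mul_of_nonneg_left (hT.traceNorm_apply_le_kappaTr_mul hX hX0) (kappaTr_nonneg S)
    _ = kappaTr S * kappaTr T * traceNorm X := by ring

end CPTP

/-! ### Measurability of the coefficient. -/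

section Measurability

variable {Ω : Type*} [MeasurableSpace Ω] {d : ℕ}

theorem MeasurableSuperOpFamily.comp {Φ Ψ : Ω → SuperOp d} (hΦ : MeasurableSuperOpFamily Φ)
    (hΨ : MeasurableSuperOpFamily Ψ) : MeasurableSuperOpFamily fun ω => Φ ω ∘ₗ Ψ ω := by
  intro X i j
  have h : (fun ω => (Φ ω ∘ₗ Ψ ω) X i j)
      = fun ω => ∑ a, ∑ b, Ψ ω X a b * Φ ω (Matrix.single a b 1) i j := by
    funext ω
    rw [LinearMap.comp_apply]
    conv_lhs => rw [Matrix.matrix_eq_sum_single (Ψ ω X)]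
    simp only [map_sum, Matrix.sum_apply]
    refine Finset.sum_congr rfl fun a _ => Finset.sum_congr rfl fun b _ => ?_
    rw [← mul_one (Ψ ω X a b), ← smul_eq_mul, ← Matrix.smul_single, map_smul, Matrix.smul_apply]
    simp
  rw [h]
  exact Finset.measurable_sum _ fun a _ => Finset.measurable_sum _ fun b _ =>
    (hΨ X a b).mul (hΦ _ i j)

theorem MeasurableSuperOpFamily.measurable_traceNorm_apply {Φ : Ω → SuperOp d}
    (hΦ : MeasurableSuperOpFamily Φ) (X : MatC d) : Measurable fun ω => traceNorm (Φ ω X) := by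
  have h : Measurable fun ω => (fun i j => Φ ω X i j : Fin d → Fin d → ℂ) :=
    measurable_pi_lambda _ fun i => measurable_pi_lambda _ fun j => hΦ X i j
  exact (show Continuous fun f : Fin d → Fin d → ℂ => traceNorm (Matrix.of f) from
    continuous_traceNorm).measurable.comp h

theorem MeasurableSuperOpFamily.measurable_kappaTr {Φ : Ω → SuperOp d}
    (hΦ : MeasurableSuperOpFamily Φ) (hcp : ∀ ω, IsCPTP (Φ ω)) :
    Measurable fun ω => kappaTr (Φ ω) := by
  let V : Set (MatC d) := {X | X.IsHermitian ∧ X.trace = 0 ∧ X ≠ 0}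
  have : SecondCountableTopology (MatC d) :=
    inferInstanceAs (SecondCountableTopology (Fin d → Fin d → ℂ))
  rcases isEmpty_or_nonempty V with hV | hV
  · have h : (fun ω => kappaTr (Φ ω)) = fun _ => 0 := by
      funext ω
      refine le_antisymm (Real.sSup_le ?_ le_rfl) (kappaTr_nonneg _)
      rintro r ⟨X, hX, hX0, hne, rfl⟩
      exact (hV.false ⟨X, hX, hX0, hne⟩).elim
    rw [h]
    exact measurable_const
  -- For each `ω` the ratio is continuous on `V`, so the supremum may be taken over a countable
  -- dense subset.
  · let u : ℕ → V := TopologicalSpace.denseSeq V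
    have hu : DenseRange u := TopologicalSpace.denseRange_denseSeq V
    have hbdd : ∀ ω, BddAbove (Set.range fun n =>
        traceNorm (Φ ω (u n : MatC d)) / traceNorm (u n : MatC d)) := by
      intro ω
      refine ⟨1, ?_⟩
      rintro r ⟨n, rfl⟩
      exact (hcp ω).ratio_le_one (u n).2.1
    have h : (fun ω => kappaTr (Φ ω)) = fun ω =>
        ⨆ n, traceNorm (Φ ω (u n : MatC d)) / traceNorm (u n : MatC d) := by
      funext ω
      have hcont : Continuous (Φ ω : MatC d → MatC d) :=
        (show (Fin d → Fin d → ℂ) →ₗ[ℂ] (Fin d → Fin d → ℂ) from Φ ω).continuous_of_finiteDimensional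
      apply le_antisymm
      · refine Real.sSup_le ?_ (Real.iSup_nonneg fun n =>
          div_nonneg (traceNorm_nonneg _) (traceNorm_nonneg _))
        rintro r ⟨X, hX, hX0, hne, rfl⟩
        have hclosed : IsClosed {Y : V | traceNorm (Φ ω (Y : MatC d)) / traceNorm (Y : MatC d) ≤
            ⨆ n, traceNorm (Φ ω (u n : MatC d)) / traceNorm (u n : MatC d)} := by
          refine isClosed_le (Continuous.div ?_ ?_ fun Y => (traceNorm_pos Y.2.2.2).ne')
            continuous_const
          · exact continuous_traceNorm.comp (hcont.comp continuous_subtype_val)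
          · exact continuous_traceNorm.comp continuous_subtype_val
        exact isClosed_property hu hclosed (fun n => le_ciSup (hbdd ω) n) ⟨X, hX, hX0, hne⟩
      · refine ciSup_le fun n => ?_
        rw [div_le_iff₀ (traceNorm_pos (u n).2.2.2)]
        exact (hcp ω).traceNorm_apply_le_kappaTr_mul (u n).2.1 (u n).2.2.1
    rw [h]
    exact Measurable.iSup fun n => (hΦ.measurable_traceNorm_apply _).div_const _

end Measurability

/-! ### Maximal ergodic inequality and frequency of visits. -/

section MaximalErgodic

variable {Ω : Type*}

/-- The running maximum of `0` and the first `n` Birkhoff sums of `g`, in recursive form. -/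
noncomputable def birkhoffMax (θ : Ω → Ω) (g : Ω → ℝ) : ℕ → Ω → ℝ
  | 0 => fun _ => 0
  | n + 1 => fun ω => max 0 (g ω + birkhoffMax θ g n (θ ω))

theorem birkhoffMax_nonneg (θ : Ω → Ω) (g : Ω → ℝ) (n : ℕ) (ω : Ω) : 0 ≤ birkhoffMax θ g n ω := by
  cases n
  · exact le_rfl
  · exact le_max_left _ _

theorem birkhoffMax_le_succ (θ : Ω → Ω) (g : Ω → ℝ) (n : ℕ) (ω : Ω) :
    birkhoffMax θ g n ω ≤ birkhoffMax θ g (n + 1) ω := by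
  induction n generalizing ω with
  | zero => exact birkhoffMax_nonneg _ _ _ _
  | succ n ih => exact max_le_max le_rfl (by gcongr; exact ih _)

theorem birkhoffSum_le_birkhoffMax (θ : Ω → Ω) (g : Ω → ℝ) (n : ℕ) (ω : Ω) :
    birkhoffSum θ g n ω ≤ birkhoffMax θ g n ω := by
  induction n generalizing ω with
  | zero => simp [birkhoffMax]
  | succ n ih =>
    rw [birkhoffSum_succ']
    exact le_max_of_le_right (by gcongr; exact ih _)

variable [MeasurableSpace Ω] {μ : Measure Ω} {θ : Ω → Ω}

theorem measurable_birkhoffMax (hθ : Measurable θ) {g : Ω → ℝ} (hg : Measurable g) (n : ℕ) :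
    Measurable (birkhoffMax θ g n) := by
  induction n with
  | zero => exact measurable_const
  | succ n ih => exact measurable_const.max (hg.add (ih.comp hθ))

theorem integrable_birkhoffMax (hθ : MeasurePreserving θ μ μ) {g : Ω → ℝ} (hg : Integrable g μ)
    (n : ℕ) : Integrable (birkhoffMax θ g n) μ := by
  induction n with
  | zero => exact integrable_zero _ _ _
  | succ n ih =>
    exact (integrable_zero _ _ _).sup (hg.add (hθ.integrable_comp_of_integrable ih))

/-- The maximal ergodic inequality. -/
theorem setIntegral_birkhoffMax_pos_nonneg (hθ : MeasurePreserving θ μ μ) {g : Ω → ℝ}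
    (hgm : Measurable g) (hg : Integrable g μ) (n : ℕ) :
    0 ≤ ∫ ω in {ω | 0 < birkhoffMax θ g n ω}, g ω ∂μ := by
  cases n with
  | zero => simp [birkhoffMax]
  | succ n =>
    set F := birkhoffMax θ g (n + 1) with hF
    have hFm : Measurable F := measurable_birkhoffMax hθ.measurable hgm _
    have hFi : Integrable F μ := integrable_birkhoffMax hθ hg _
    have hFθ : Integrable (fun ω => F (θ ω)) μ := hθ.integrable_comp_of_integrable hFi
    have hE : MeasurableSet {ω | 0 < F ω} := measurableSet_lt measurable_const hFm
    have h0 : ∀ ω, 0 ≤ F ω := birkhoffMax_nonneg _ _ _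
    have h1 : ∫ ω in {ω | 0 < F ω}, F ω ∂μ = ∫ ω, F ω ∂μ := by
      refine setIntegral_eq_integral_of_forall_compl_eq_zero fun ω hω => ?_
      exact le_antisymm (not_lt.mp hω) (h0 ω)
    have h2 : ∫ ω in {ω | 0 < F ω}, F (θ ω) ∂μ ≤ ∫ ω, F (θ ω) ∂μ :=
      setIntegral_le_integral hFθ (ae_of_all _ fun ω => h0 _)
    have h3 : ∫ ω, F (θ ω) ∂μ = ∫ ω, F ω ∂μ := by
      have := integral_map hθ.measurable.aemeasurable (μ := μ) (f := F)
        hFm.aestronglyMeasurable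
      rw [hθ.map_eq] at this
      exact this.symm
    -- Where `F > 0`, the recursion gives `F = g + birkhoffMax θ g n ∘ θ ≤ g + F ∘ θ`. Since `F` and
    -- `F ∘ θ` have equal integrals, the left side is nonnegative.
    have h4 : ∫ ω in {ω | 0 < F ω}, (F ω - F (θ ω)) ∂μ ≤ ∫ ω in {ω | 0 < F ω}, g ω ∂μ := by
      refine setIntegral_mono_on (hFi.sub hFθ).integrableOn hg.integrableOn hE fun ω hω => ?_
      have hω' : 0 < max 0 (g ω + birkhoffMax θ g n (θ ω)) := hω
      have hFω : F ω = g ω + birkhoffMax θ g n (θ ω) := by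
        rcases lt_max_iff.mp hω' with h | h
        · exact (lt_irrefl _ h).elim
        · exact max_eq_right h.le
      have := birkhoffMax_le_succ θ g n (θ ω)
      rw [← hF] at this
      linarith
    rw [integral_sub hFi.integrableOn hFθ.integrableOn] at h4
    linarith

/-- The maximal inequality for `1_B - r` gives `r μ(E n) ≤ μ(E n ∩ B)`; the increasing sets `E n`
exhaust a set containing the one to be bounded. -/
theorem measureReal_exists_lt_birkhoffSum_indicator_le [IsProbabilityMeasure μ]
    (hθ : MeasurePreserving θ μ μ)
    {B : Set Ω} (hB : MeasurableSet B) {r : ℝ} (hr : 0 < r) :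
    μ.real {ω | ∃ n : ℕ, r * n < birkhoffSum θ (B.indicator fun _ => (1 : ℝ)) n ω}
      ≤ μ.real B / r := by
  set b : Ω → ℝ := B.indicator fun _ => (1 : ℝ) with hb
  have hbm : Measurable b := measurable_const.indicator hB
  have hbi : Integrable b μ := (integrable_const 1).indicator hB
  set g : Ω → ℝ := fun ω => b ω - r with hg
  have hgm : Measurable g := hbm.sub_const r
  have hgi : Integrable g μ := hbi.sub (integrable_const r)
  have hsum : ∀ (n : ℕ) ω, birkhoffSum θ g n ω = birkhoffSum θ b n ω - r * n := by
    intro n ω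
    simp [birkhoffSum, hg, mul_comm]
  let E : ℕ → Set Ω := fun n => {ω | 0 < birkhoffMax θ g n ω}
  have hmono : Monotone E :=
    monotone_nat_of_le_succ fun n ω hω => lt_of_lt_of_le hω (birkhoffMax_le_succ θ g n ω)
  have hE : ∀ n, μ.real (E n) ≤ μ.real B / r := by
    intro n
    have h := setIntegral_birkhoffMax_pos_nonneg hθ hgm hgi n
    rw [integral_sub hbi.integrableOn (integrable_const r).integrableOn, hb,
      setIntegral_indicator hB] at h
    simp only [setIntegral_const, smul_eq_mul, mul_one] at h
    rw [le_div_iff₀ hr]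
    have : μ.real (E n ∩ B) ≤ μ.real B := measureReal_mono Set.inter_subset_right
    simp only [E] at this ⊢
    linarith
  calc μ.real {ω | ∃ n : ℕ, r * n < birkhoffSum θ b n ω} ≤ μ.real (⋃ n, E n) := by
        refine measureReal_mono ?_
        rintro ω ⟨n, hn⟩
        refine Set.mem_iUnion.mpr ⟨n, lt_of_lt_of_le ?_ (birkhoffSum_le_birkhoffMax θ g n ω)⟩
        rw [hsum]; linarith
    _ ≤ μ.real B / r :=
        le_of_tendsto' ((ENNReal.tendsto_toReal (measure_ne_top μ _)).comp
          (tendsto_measure_iUnion_atTop hmono)) hE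

end MaximalErgodic

/-! ### Ergodic theory of contractive cocycles. -/

section Cocycle

variable {Ω : Type*} [MeasurableSpace Ω]

/-- A measurable submultiplicative cocycle over `θ` with values in `[0, 1]`. -/
structure IsContractiveCocycle (θ : Ω → Ω) (κ : ℕ → Ω → ℝ) : Prop where
  measurable : ∀ n, Measurable (κ n)
  nonneg : ∀ n ω, 0 ≤ κ n ω
  le_one : ∀ n ω, κ n ω ≤ 1
  add_le : ∀ n m ω, κ (n + m) ω ≤ κ n ω * κ m (θ^[n] ω)

variable {μ : Measure Ω} {θ : Ω → Ω} {κ : ℕ → Ω → ℝ}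

/-- A measurable set containing its preimage is almost everywhere forward invariant. -/
theorem ae_forall_iterate_mem [IsProbabilityMeasure μ] (hθ : MeasurePreserving θ μ μ) {J : Set Ω}
    (hJ : MeasurableSet J) (hsub : θ ⁻¹' J ⊆ J) :
    ∀ᵐ ω ∂μ, ω ∈ J → ∀ k, θ^[k] ω ∈ J := by
  have h1 : ∀ᵐ ω ∂μ, ω ∈ J → θ ω ∈ J := by
    have h := measure_sdiff hsub (hθ.measurable hJ).nullMeasurableSet (measure_ne_top μ _)
    rw [hθ.measure_preimage hJ.nullMeasurableSet, tsub_self] at h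
    filter_upwards [measure_eq_zero_iff_ae_notMem.mp h] with ω hω hωJ
    by_contra hcon
    exact hω ⟨hωJ, hcon⟩
  have h2 : ∀ᵐ ω ∂μ, ∀ k, θ^[k] ω ∈ J → θ (θ^[k] ω) ∈ J :=
    ae_all_iff.mpr fun k => (hθ.iterate k).quasiMeasurePreserving.ae h1
  filter_upwards [h2] with ω hω hωJ k
  induction k with
  | zero => exact hωJ
  | succ k ih => rw [Function.iterate_succ_apply']; exact hω k ih

namespace IsContractiveCocycle

theorem succ_le (h : IsContractiveCocycle θ κ) (n : ℕ) (ω : Ω) : κ (n + 1) ω ≤ κ n ω :=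
  (h.add_le n 1 ω).trans (mul_le_of_le_one_right (h.nonneg n ω) (h.le_one _ _))

theorem antitone (h : IsContractiveCocycle θ κ) (ω : Ω) : Antitone fun n => κ n ω :=
  antitone_nat_of_succ_le fun n => h.succ_le n ω

theorem succ_le_comp (h : IsContractiveCocycle θ κ) (n : ℕ) (ω : Ω) :
    κ (n + 1) ω ≤ κ n (θ ω) := by
  rw [add_comm]
  exact (h.add_le 1 n ω).trans (mul_le_of_le_one_left (h.nonneg _ _) (h.le_one _ _))

/-- Follow the orbit greedily: jump over a good block, or take one step from a point of `B`. Only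
steps from `B` and a final stretch of length at most `N` fail to contribute decay. -/
theorem le_exp_of_block_decomposition (h : IsContractiveCocycle θ κ) {J B : Set Ω} {c : ℝ}
    (hc : c ≤ 0) {N : ℕ} (hJ : ∀ ω ∈ J, θ ω ∈ J)
    (hB : ∀ ω ∈ J, ω ∉ B → ∃ l, 1 ≤ l ∧ l ≤ N ∧ κ l ω ≤ Real.exp (c * l)) (n : ℕ) :
    ∀ ω ∈ J, κ n ω ≤
      Real.exp (c * (n - N - birkhoffSum θ (B.indicator fun _ => (1 : ℝ)) n ω)) := by
  set b : Ω → ℝ := B.indicator fun _ => (1 : ℝ) with hb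
  have hb0 : ∀ ω, 0 ≤ b ω := fun ω => Set.indicator_nonneg (fun _ _ => zero_le_one) ω
  have hS : ∀ m ω, 0 ≤ birkhoffSum θ b m ω := fun m ω => Finset.sum_nonneg fun _ _ => hb0 _
  have hJit : ∀ k, ∀ ω ∈ J, θ^[k] ω ∈ J := by
    intro k
    induction k with
    | zero => exact fun ω hω => hω
    | succ k ih => exact fun ω hω => ih _ (hJ ω hω)
  induction n using Nat.strong_induction_on with
  | _ n ih =>
    intro ω hω
    rcases le_or_gt n N with hn | hn
    · refine (h.le_one n ω).trans (Real.one_le_exp (mul_nonneg_of_nonpos_of_nonpos hc ?_))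
      have : (n : ℝ) ≤ N := by exact_mod_cast hn
      linarith [hS n ω]
    · by_cases hωB : ω ∈ B
      · obtain ⟨m, rfl⟩ : ∃ m, n = m + 1 := ⟨n - 1, by omega⟩
        -- Skipping one bad step lowers both `n` and the visit count by one, leaving the exponent
        -- unchanged.
        refine (h.succ_le_comp m ω).trans ((ih m (by omega) _ (hJ ω hω)).trans_eq ?_)
        have : b ω = 1 := Set.indicator_of_mem hωB _
        rw [birkhoffSum_succ', this]
        push_cast
        ring_nf
      · obtain ⟨l, hl1, hlN, hl⟩ := hB ω hω hωB
        obtain ⟨m, rfl⟩ : ∃ m, n = l + m := ⟨n - l, by omega⟩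
        calc κ (l + m) ω ≤ κ l ω * κ m (θ^[l] ω) := h.add_le l m ω
          _ ≤ Real.exp (c * l) *
              Real.exp (c * (m - N - birkhoffSum θ b m (θ^[l] ω))) :=
            mul_le_mul hl (ih m (by omega) _ (hJit l ω hω)) (h.nonneg _ _) (Real.exp_nonneg _)
          _ ≤ _ := by
            rw [← Real.exp_add, birkhoffSum_add]
            refine Real.exp_le_exp.mpr ?_
            push_cast
            nlinarith [hS l ω, mul_nonneg_of_nonpos_of_nonpos hc (neg_nonpos.mpr (hS l ω))]

/-- Frequent exponential decay at rate `c` forces, almost everywhere, eventual exponential decay at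
every slower rate: the essential content of the subadditive ergodic theorem. -/
theorem ae_eventually_le_exp [IsProbabilityMeasure μ] (h : IsContractiveCocycle θ κ)
    (hθ : MeasurePreserving θ μ μ) {c c' : ℝ} (hcc : c < c') (hc' : c' < 0) :
    ∀ᵐ ω ∂μ, (∃ᶠ n : ℕ in atTop, κ n ω ≤ Real.exp (c * n)) →
      ∀ᶠ n : ℕ in atTop, κ n ω ≤ Real.exp (c' * n) := by
  -- The slack `k` absorbs the change of exponent under a shift by one, which gives `θ ⁻¹' J ⊆ J`.
  let J : Set Ω := ⋃ k : ℕ, ⋂ a : ℕ, ⋃ n : ℕ, ⋃ _ : a ≤ n, {ω | κ n ω ≤ Real.exp (c * n + k)}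
  have memJ : ∀ ω, ω ∈ J ↔ ∃ k : ℕ, ∀ a : ℕ, ∃ n, a ≤ n ∧ κ n ω ≤ Real.exp (c * n + k) := by
    intro ω; simp [J]
  have hJm : MeasurableSet J :=
    MeasurableSet.iUnion fun k => MeasurableSet.iInter fun a => MeasurableSet.iUnion fun n =>
      MeasurableSet.iUnion fun _ => measurableSet_le (h.measurable n) measurable_const
  have hJsub : θ ⁻¹' J ⊆ J := by
    intro ω hω
    obtain ⟨k, hk⟩ := (memJ _).mp hω
    obtain ⟨k', hk'⟩ := exists_nat_ge ((k : ℝ) - c)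
    refine (memJ _).mpr ⟨k', fun a => ?_⟩
    obtain ⟨n, hn, hle⟩ := hk a
    refine ⟨n + 1, by omega, (h.succ_le_comp n ω).trans (hle.trans (Real.exp_le_exp.mpr ?_))⟩
    push_cast
    linarith
  set c₁ : ℝ := (c + c') / 2 with hc₁
  have hcc₁ : c < c₁ := by rw [hc₁]; linarith
  have hc₁c' : c₁ < c' := by rw [hc₁]; linarith
  have hc₁0 : c₁ < 0 := hc₁c'.trans hc'
  -- With this `r`, bad visits of frequency at most `r` cost half of the gap between `c₁` and `c'`.
  set r : ℝ := (c₁ - c') / (2 * c₁) with hr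
  have hr0 : 0 < r := div_pos_of_neg_of_neg (by linarith) (by linarith)
  have hrc : c₁ * r = (c₁ - c') / 2 := by rw [hr]; field_simp [hc₁0.ne]
  -- Points of `J` where no block of length at most `N` decays at rate `c₁`. They shrink to the
  -- empty set because `c * n + k ≤ c₁ * n` for large `n`.
  let B : ℕ → Set Ω := fun N => J ∩ ⋂ l : ℕ, ⋂ _ : 1 ≤ l ∧ l ≤ N, {ω | Real.exp (c₁ * l) < κ l ω}
  have memB : ∀ N ω, ω ∈ B N ↔ ω ∈ J ∧ ∀ l : ℕ, 1 ≤ l ∧ l ≤ N → Real.exp (c₁ * l) < κ l ω := by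
    intro N ω; simp [B]
  have hBm : ∀ N, MeasurableSet (B N) := fun N =>
    hJm.inter (MeasurableSet.iInter fun l => MeasurableSet.iInter fun _ =>
      measurableSet_lt measurable_const (h.measurable l))
  have hBanti : Antitone B := by
    intro N M hNM ω hω
    rw [memB] at hω ⊢
    exact ⟨hω.1, fun l hl => hω.2 l ⟨hl.1, hl.2.trans hNM⟩⟩
  have hBempty : ⋂ N, B N = ∅ := by
    refine Set.eq_empty_of_forall_notMem fun ω hω => ?_
    rw [Set.mem_iInter] at hω
    obtain ⟨k, hk⟩ := (memJ ω).mp ((memB 0 ω).mp (hω 0)).1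
    obtain ⟨a, ha⟩ := exists_nat_ge ((k : ℝ) / (c₁ - c))
    obtain ⟨n, hn, hle⟩ := hk (a + 1)
    have hlt := ((memB n ω).mp (hω n)).2 n ⟨by omega, le_rfl⟩
    have han : (a : ℝ) ≤ n := by exact_mod_cast (by omega : a ≤ n)
    rw [div_le_iff₀ (by linarith)] at ha
    have := Real.exp_lt_exp.mp (hlt.trans_le hle)
    nlinarith
  have hBlim : Tendsto (fun N => μ.real (B N)) atTop (𝓝 0) := by
    have := tendsto_measure_iInter_atTop (μ := μ) (fun N => (hBm N).nullMeasurableSet) hBanti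
      ⟨0, measure_ne_top μ _⟩
    rw [hBempty, measure_empty] at this
    exact (ENNReal.tendsto_toReal ENNReal.zero_ne_top).comp this
  let D : ℕ → Set Ω := fun N =>
    {ω | ∃ n : ℕ, r * n < birkhoffSum θ ((B N).indicator fun _ => (1 : ℝ)) n ω}
  have hD : ∀ᵐ ω ∂μ, ∃ N, ω ∉ D N := by
    have h0 : μ.real (⋂ N, D N) ≤ 0 := by
      have hlim : Tendsto (fun N => μ.real (B N) / r) atTop (𝓝 0) := by
        simpa using hBlim.div_const r
      exact ge_of_tendsto' hlim fun N => (measureReal_mono (Set.iInter_subset _ N)).trans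
        (measureReal_exists_lt_birkhoffSum_indicator_le hθ (hBm N) hr0)
    have h0' : μ (⋂ N, D N) = 0 :=
      (measureReal_eq_zero_iff (measure_ne_top μ _)).mp (le_antisymm h0 measureReal_nonneg)
    filter_upwards [measure_eq_zero_iff_ae_notMem.mp h0'] with ω hω
    simpa using hω
  filter_upwards [ae_forall_iterate_mem hθ hJm hJsub, hD] with ω hωJ hωD hfreq
  obtain ⟨N, hN⟩ := hωD
  have hmem : ω ∈ {ω | ∀ k, θ^[k] ω ∈ J} := by
    refine hωJ ((memJ ω).mpr ⟨0, fun a => ?_⟩)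
    obtain ⟨n, hn, hle⟩ := (frequently_atTop.mp hfreq) a
    exact ⟨n, hn, by simpa using hle⟩
  -- Points whose whole forward orbit lies in `J` form an exactly forward-invariant set, as the
  -- block lemma requires.
  have key := fun n => h.le_exp_of_block_decomposition (J := {ω | ∀ k, θ^[k] ω ∈ J}) (B := B N)
    hc₁0.le (N := N) (fun ω hω k => hω (k + 1)) (fun ω hω hB => by
      by_contra! hcon
      exact hB ((memB N ω).mpr ⟨hω 0, fun l hl => hcon l hl.1 hl.2⟩)) n ω hmem
  -- The other half of the gap absorbs the constant `-c₁ * N` once `n ≥ a`.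
  obtain ⟨a, ha⟩ := exists_nat_ge (-c₁ * N / ((c' - c₁) / 2))
  rw [div_le_iff₀ (by linarith)] at ha
  filter_upwards [eventually_ge_atTop a] with n hn
  refine (key n).trans (Real.exp_le_exp.mpr ?_)
  have hS : birkhoffSum θ ((B N).indicator fun _ => (1 : ℝ)) n ω ≤ r * n := by
    by_contra! hcon
    exact hN ⟨n, hcon⟩
  have hS' : c₁ * (r * n) ≤ c₁ * birkhoffSum θ ((B N).indicator fun _ => (1 : ℝ)) n ω :=
    mul_le_mul_of_nonpos_left hS hc₁0.le
  rw [← mul_assoc, hrc] at hS'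
  have han : (a : ℝ) ≤ n := by exact_mod_cast hn
  nlinarith [mul_le_mul_of_nonneg_right han (by linarith : (0 : ℝ) ≤ (c' - c₁) / 2)]

/-- Submultiplicativity over `m` blocks of length `n`, with `x ≤ exp (-(1 - x))` for each factor. -/
theorem mul_le_exp_sum (h : IsContractiveCocycle θ κ) (n m : ℕ) (ω : Ω) :
    κ (n * m) ω ≤ Real.exp (-∑ j ∈ Finset.range m, (1 - κ n (θ^[n * j] ω))) := by
  induction m with
  | zero => simpa using h.le_one 0 ω
  | succ m ih =>
    rw [Finset.sum_range_succ, neg_add, Real.exp_add, Nat.mul_succ]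
    refine (h.add_le _ _ _).trans (mul_le_mul ih ?_ (h.nonneg _ _) (Real.exp_nonneg _))
    have := Real.add_one_le_exp (-(1 - κ n (θ^[n * m] ω)))
    linarith

/-- On the set where the cocycle decays subexponentially, it is almost everywhere constantly `1`. -/
theorem ae_eq_one_of_subexponential [IsProbabilityMeasure μ] (h : IsContractiveCocycle θ κ)
    (hθ : MeasurePreserving θ μ μ) (n : ℕ) :
    ∀ᵐ ω ∂μ, (∀ c < 0, ∀ᶠ m : ℕ in atTop, Real.exp (c * m) < κ m ω) → κ n ω = 1 := by
  -- `κ 0` need not be `1`, but `κ 0 ≤ (κ 0)²` and `κ 0 > 0` force it.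
  rcases Nat.eq_zero_or_pos n with rfl | hn
  · refine ae_of_all _ fun ω hω => le_antisymm (h.le_one _ _) ?_
    have h1 : 0 < κ 0 ω := by
      obtain ⟨m, hm⟩ := (hω (-1) (by norm_num)).exists
      exact ((Real.exp_pos _).trans hm).trans_le (h.antitone ω (Nat.zero_le m))
    have := h.add_le 0 0 ω
    simp only [add_zero, Function.iterate_zero, id_eq] at this
    nlinarith
  let I : Set Ω := ⋂ p : ℕ, ⋃ a : ℕ, ⋂ m : ℕ, ⋂ _ : a ≤ m,
    {ω | Real.exp (-(1 / ((p : ℝ) + 1)) * m) < κ m ω}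
  have memI : ∀ ω, ω ∈ I ↔ ∀ p : ℕ, ∃ a : ℕ, ∀ m, a ≤ m →
      Real.exp (-(1 / ((p : ℝ) + 1)) * m) < κ m ω := by
    intro ω; simp [I]
  have hIm : MeasurableSet I :=
    MeasurableSet.iInter fun p => MeasurableSet.iUnion fun a => MeasurableSet.iInter fun m =>
      MeasurableSet.iInter fun _ => measurableSet_lt measurable_const (h.measurable m)
  have hIinv : ∀ ω ∈ I, θ ω ∈ I := by
    intro ω hω
    rw [memI] at hω ⊢
    intro p
    -- Index `2p + 1` halves the rate, and `(m + 1) / 2 ≤ m` for `m ≥ 1` pays for the shift.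
    obtain ⟨a, ha⟩ := hω (2 * p + 1)
    refine ⟨a + 1, fun m hm => (lt_of_le_of_lt ?_ (ha (m + 1) (by omega))).trans_le
      (h.succ_le_comp m ω)⟩
    refine Real.exp_le_exp.mpr ?_
    have hm1 : (1 : ℝ) ≤ m := by exact_mod_cast (by omega : 1 ≤ m)
    have hp : (0 : ℝ) < 1 / ((p : ℝ) + 1) := by positivity
    have hhalf : 1 / (2 * (p : ℝ) + 1 + 1) = 1 / ((p : ℝ) + 1) / 2 := by
      rw [div_div]; congr 1; ring
    push_cast
    rw [hhalf]
    nlinarith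
  -- `I` lies in its preimage, which has the same finite measure, so the reverse inclusion holds
  -- a.e.
  have hIae : ∀ k, ∀ᵐ ω ∂μ, θ^[k] ω ∈ I → ω ∈ I := by
    intro k
    have hsub : I ⊆ θ^[k] ⁻¹' I := by
      induction k with
      | zero => exact fun ω hω => hω
      | succ k ih => exact fun ω hω => ih (hIinv ω hω)
    have hm := measure_sdiff hsub hIm.nullMeasurableSet (measure_ne_top μ _)
    rw [(hθ.iterate k).measure_preimage hIm.nullMeasurableSet, tsub_self] at hm
    filter_upwards [measure_eq_zero_iff_ae_notMem.mp hm] with ω hω hωI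
    by_contra hcon
    exact hω ⟨hωI, hcon⟩
  have hIfwd : ∀ k, ∀ ω ∈ I, θ^[k] ω ∈ I := by
    intro k
    induction k with
    | zero => exact fun ω hω => hω
    | succ k ih => exact fun ω hω => ih _ (hIinv ω hω)
  let g : Ω → ℝ := fun ω => 1 - κ n ω
  have hgm : Measurable g := measurable_const.sub (h.measurable n)
  have hg0 : ∀ ω, 0 ≤ g ω := fun ω => sub_nonneg.mpr (h.le_one n ω)
  have hg1 : ∀ ω, g ω ≤ 1 := fun ω => sub_le_self _ (h.nonneg n ω)
  have hgθm : ∀ j, Measurable fun ω => g (θ^[n * j] ω) := fun j =>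
    hgm.comp (hθ.iterate _).measurable
  have hGm : Measurable (I.indicator g) := hgm.indicator hIm
  have hterm : ∀ j, ∫ ω, I.indicator (fun ω => g (θ^[n * j] ω)) ω ∂μ = ∫ ω, I.indicator g ω ∂μ := by
    intro j
    -- Almost-invariance of `I` lets the indicator move along the orbit, so every term has the same
    -- integral.
    have h1 : I.indicator (fun ω => g (θ^[n * j] ω)) =ᵐ[μ]
        fun ω => I.indicator g (θ^[n * j] ω) := by
      filter_upwards [hIae (n * j)] with ω hω
      by_cases hωI : ω ∈ I
      · rw [Set.indicator_of_mem hωI, Set.indicator_of_mem (hIfwd _ ω hωI)]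
      · rw [Set.indicator_of_notMem hωI, Set.indicator_of_notMem fun hc => hωI (hω hc)]
    rw [integral_congr_ae h1]
    have := integral_map (hθ.iterate (n * j)).measurable.aemeasurable (μ := μ)
      (f := I.indicator g) hGm.aestronglyMeasurable
    rw [(hθ.iterate (n * j)).map_eq] at this
    exact this.symm
  let A : ℕ → Ω → ℝ := fun m => I.indicator fun ω =>
    (∑ j ∈ Finset.range m, g (θ^[n * j] ω)) / m
  have hAm : ∀ m, Measurable (A m) := fun m =>
    ((Finset.measurable_sum _ fun j _ => hgθm j).div_const _).indicator hIm
  have hAint : ∀ m : ℕ, 0 < m → ∫ ω, A m ω ∂μ = ∫ ω, I.indicator g ω ∂μ := by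
    intro m hm
    have h1 : A m = fun ω =>
        (∑ j ∈ Finset.range m, I.indicator (fun ω => g (θ^[n * j] ω)) ω) / m := by
      funext ω
      by_cases hωI : ω ∈ I <;> simp [A, hωI]
    rw [h1, integral_div, integral_finsetSum]
    · rw [Finset.sum_congr rfl fun j _ => hterm j, Finset.sum_const, Finset.card_range,
        nsmul_eq_mul, mul_div_cancel_left₀]
      exact_mod_cast hm.ne'
    · intro j _
      refine Integrable.indicator ?_ hIm
      refine Integrable.of_bound (hgθm j).aestronglyMeasurable 1 (ae_of_all _ fun ω => ?_)
      rw [Real.norm_of_nonneg (hg0 _)]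
      exact hg1 _
  have hA0 : ∀ m ω, 0 ≤ A m ω := fun m ω => Set.indicator_nonneg
    (fun ω _ => div_nonneg (Finset.sum_nonneg fun j _ => hg0 _) (Nat.cast_nonneg m)) ω
  have hA1 : ∀ m ω, A m ω ≤ 1 := by
    intro m ω
    refine Set.indicator_apply_le' (fun _ => ?_) fun _ => zero_le_one
    refine div_le_one_of_le₀ ?_ (Nat.cast_nonneg m)
    exact (Finset.sum_le_card_nsmul _ _ 1 fun j _ => hg1 _).trans (by simp)
  have hAlim : ∀ ω, Tendsto (fun m => A m ω) atTop (𝓝 0) := by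
    intro ω
    by_cases hωI : ω ∈ I
    · rw [Metric.tendsto_atTop]
      intro ε hε
      -- Division by `n`: the exponent at time `n * m` is averaged over only `m` blocks.
      obtain ⟨p, hp⟩ := exists_nat_one_div_lt (show 0 < ε / n by positivity)
      obtain ⟨a, ha⟩ := (memI ω).mp hωI p
      refine ⟨a + 1, fun m hm => ?_⟩
      have h1 := ha (n * m) (by nlinarith)
      have h2 := Real.exp_lt_exp.mp (h1.trans_le (h.mul_le_exp_sum n m ω))
      have hm0 : (0 : ℝ) < m := by exact_mod_cast (by omega : 0 < m)
      have hn0 : (0 : ℝ) < n := by exact_mod_cast hn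
      rw [Real.dist_eq, sub_zero, abs_of_nonneg (hA0 m ω)]
      simp only [A, Set.indicator_of_mem hωI]
      rw [div_lt_iff₀ hm0]
      rw [lt_div_iff₀ hn0] at hp
      push_cast at h2
      simp only [g]
      nlinarith [mul_lt_mul_of_pos_right hp hm0]
    · simp [A, hωI]
  have hint : ∫ ω, I.indicator g ω ∂μ = 0 := by
    have h1 : Tendsto (fun m => ∫ ω, A m ω ∂μ) atTop (𝓝 (∫ _, (0 : ℝ) ∂μ)) :=
      tendsto_integral_of_dominated_convergence (fun _ => 1)
        (fun m => (hAm m).aestronglyMeasurable) (integrable_const 1)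
        (fun m => ae_of_all _ fun ω => by
          rw [Real.norm_of_nonneg (hA0 m ω)]; exact hA1 m ω)
        (ae_of_all _ hAlim)
    rw [integral_zero] at h1
    refine tendsto_nhds_unique (Tendsto.congr' ?_ tendsto_const_nhds) h1
    filter_upwards [eventually_gt_atTop 0] with m hm
    exact (hAint m hm).symm
  have hGint : Integrable (I.indicator g) μ := by
    refine Integrable.indicator ?_ hIm
    refine Integrable.of_bound hgm.aestronglyMeasurable 1 (ae_of_all _ fun ω => ?_)
    rw [Real.norm_of_nonneg (hg0 _)]
    exact hg1 _
  have hzero := (integral_eq_zero_iff_of_nonneg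
    (fun ω => Set.indicator_nonneg (fun ω _ => hg0 ω) ω) hGint).mp hint
  filter_upwards [hzero] with ω hω hsub
  have hωI : ω ∈ I := by
    refine (memI ω).mpr fun p => ?_
    exact eventually_atTop.mp (hsub (-(1 / ((p : ℝ) + 1))) (neg_neg_of_pos (by positivity)))
  rw [Set.indicator_of_mem hωI] at hω
  exact (sub_eq_zero.mp hω).symm

theorem ae_exists_eventually_le_exp [IsProbabilityMeasure μ] (h : IsContractiveCocycle θ κ)
    (hθ : MeasurePreserving θ μ μ) (hlim : ∀ᵐ ω ∂μ, Tendsto (fun n => κ n ω) atTop (𝓝 0)) :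
    ∀ᵐ ω ∂μ, ∃ c < 0, ∀ᶠ n : ℕ in atTop, κ n ω ≤ Real.exp (c * n) := by
  have h1 := ae_all_iff.mpr fun n => h.ae_eq_one_of_subexponential hθ n
  have h2 : ∀ᵐ ω ∂μ, ∀ p : ℕ,
      (∃ᶠ n : ℕ in atTop, κ n ω ≤ Real.exp (-(1 / ((p : ℝ) + 1)) * n)) →
      ∀ᶠ n : ℕ in atTop, κ n ω ≤ Real.exp (-(1 / ((p : ℝ) + 1)) / 2 * n) := by
    refine ae_all_iff.mpr fun p => ?_
    have hp : (0 : ℝ) < 1 / ((p : ℝ) + 1) := by positivity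
    exact h.ae_eventually_le_exp hθ (by linarith) (by linarith)
  filter_upwards [h1, h2, hlim] with ω hω1 hω2 hω
  have hnot : ¬ ∀ c < 0, ∀ᶠ m : ℕ in atTop, Real.exp (c * m) < κ m ω := by
    intro hcon
    have : Tendsto (fun n => κ n ω) atTop (𝓝 1) :=
      tendsto_const_nhds.congr fun n => (hω1 n hcon).symm
    exact zero_ne_one (tendsto_nhds_unique hω this)
  push Not at hnot
  obtain ⟨c, hc, hfreq⟩ := hnot
  obtain ⟨p, hp⟩ := exists_nat_one_div_lt (neg_pos.mpr hc)
  have hp0 : (0 : ℝ) < 1 / ((p : ℝ) + 1) := by positivity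
  refine ⟨-(1 / ((p : ℝ) + 1)) / 2, by linarith, hω2 p ?_⟩
  refine hfreq.mono fun n hn => hn.trans (Real.exp_le_exp.mpr ?_)
  exact mul_le_mul_of_nonneg_right (by linarith) (Nat.cast_nonneg n)

end IsContractiveCocycle

/-- Monotonicity gives `b n` a pointwise limit; it is nonnegative and, by dominated convergence, its
integral is the limit `0` of the integrals of `a n`. -/
theorem ae_tendsto_zero_of_integral_eq [IsProbabilityMeasure μ] {a b : ℕ → Ω → ℝ}
    (ha : ∀ n, Measurable (a n)) (hb : ∀ n, Measurable (b n))
    (ha0 : ∀ n ω, 0 ≤ a n ω) (hb0 : ∀ n ω, 0 ≤ b n ω)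
    (ha1 : ∀ n ω, a n ω ≤ 1) (hb1 : ∀ n ω, b n ω ≤ 1)
    (hb_anti : ∀ ω, Antitone fun n => b n ω) (hab : ∀ n, ∫ ω, a n ω ∂μ = ∫ ω, b n ω ∂μ)
    (hlim : ∀ᵐ ω ∂μ, Tendsto (fun n => a n ω) atTop (𝓝 0)) :
    ∀ᵐ ω ∂μ, Tendsto (fun n => b n ω) atTop (𝓝 0) := by
  have hbdd : ∀ ω, BddBelow (Set.range fun n => b n ω) := fun ω =>
    ⟨0, by rintro r ⟨n, rfl⟩; exact hb0 n ω⟩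
  have hblim : ∀ ω, Tendsto (fun n => b n ω) atTop (𝓝 (⨅ n, b n ω)) := fun ω =>
    tendsto_atTop_ciInf (hb_anti ω) (hbdd ω)
  have hinf0 : ∀ ω, 0 ≤ ⨅ n, b n ω := fun ω => Real.iInf_nonneg fun n => hb0 n ω
  have hinfm : Measurable fun ω => ⨅ n, b n ω := Measurable.iInf hb
  have hA : Tendsto (fun n => ∫ ω, a n ω ∂μ) atTop (𝓝 (∫ _, (0 : ℝ) ∂μ)) :=
    tendsto_integral_of_dominated_convergence (fun _ => 1)
      (fun n => (ha n).aestronglyMeasurable) (integrable_const 1)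
      (fun n => ae_of_all _ fun ω => by rw [Real.norm_of_nonneg (ha0 n ω)]; exact ha1 n ω) hlim
  have hB : Tendsto (fun n => ∫ ω, b n ω ∂μ) atTop (𝓝 (∫ ω, ⨅ n, b n ω ∂μ)) :=
    tendsto_integral_of_dominated_convergence (fun _ => 1)
      (fun n => (hb n).aestronglyMeasurable) (integrable_const 1)
      (fun n => ae_of_all _ fun ω => by rw [Real.norm_of_nonneg (hb0 n ω)]; exact hb1 n ω)
      (ae_of_all _ hblim)
  rw [integral_zero] at hA
  have hint : ∫ ω, ⨅ n, b n ω ∂μ = 0 := tendsto_nhds_unique hB (hA.congr hab)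
  have hinfi : Integrable (fun ω => ⨅ n, b n ω) μ := by
    refine Integrable.of_bound hinfm.aestronglyMeasurable 1 (ae_of_all _ fun ω => ?_)
    rw [Real.norm_of_nonneg (hinf0 ω)]
    exact (ciInf_le (hbdd ω) 0).trans (hb1 0 ω)
  filter_upwards [(integral_eq_zero_iff_of_nonneg hinf0 hinfi).mp hint] with ω hω
  have := hblim ω
  rwa [hω] at this

end Cocycle

/-! ### Extended-real logarithms and exponential bounds. -/

section Exponent

theorem log_ofReal_div_le_iff {x c : ℝ} {n : ℕ} (hn : 0 < n) :
    ENNReal.log (ENNReal.ofReal x) / (n : EReal) ≤ (c : EReal) ↔ x ≤ Real.exp (c * n) := by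
  have hn' : (0 : ℝ) < n := by exact_mod_cast hn
  rw [EReal.div_le_iff_le_mul (by exact_mod_cast hn) (EReal.natCast_ne_top n)]
  rcases le_or_gt x 0 with hx | hx
  · rw [ENNReal.ofReal_of_nonpos hx, ENNReal.log_zero]
    exact iff_of_true bot_le (hx.trans (Real.exp_nonneg _))
  · rw [ENNReal.log_ofReal_of_pos hx, ← Real.log_le_iff_le_exp hx]
    have : ((n : EReal) * (c : EReal)) = ((n * c : ℝ) : EReal) := by push_cast; rfl
    rw [this, EReal.coe_le_coe_iff, mul_comm]

end Exponent

/-! ### The cocycle of quantum channels. -/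

section Application

variable {Ω : Type*} [MeasurableSpace Ω] {d : ℕ} {θ : Ω ≃ᵐ Ω} {Φ : Ω → SuperOp d}

theorem thetaPow_add (i j : ℤ) (ω : Ω) : thetaPow θ (i + j) ω = thetaPow θ i (thetaPow θ j ω) := by
  simp [thetaPow, zpow_add]

theorem thetaPow_natCast (n : ℕ) (ω : Ω) : thetaPow θ n ω = θ^[n] ω := by
  rw [thetaPow, zpow_natCast, ← Equiv.Perm.iterate_eq_pow]
  rfl

theorem thetaPow_neg_natCast (n : ℕ) (ω : Ω) : thetaPow θ (-n) ω = θ.symm^[n] ω := by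
  rw [thetaPow, zpow_neg, zpow_natCast, ← inv_pow, ← Equiv.Perm.iterate_eq_pow]
  rfl

theorem blockProduct_add (ω : Ω) (s : ℤ) (n m : ℕ) :
    blockProduct θ Φ ω s (n + m) = blockProduct θ Φ ω (s + n) m ∘ₗ blockProduct θ Φ ω s n := by
  induction m with
  | zero => rfl
  | succ m ih =>
    rw [← add_assoc, blockProduct, ih, blockProduct, LinearMap.comp_assoc]
    push_cast
    rw [add_assoc]

theorem blockProduct_thetaPow (ω : Ω) (j s : ℤ) (n : ℕ) :
    blockProduct θ Φ (thetaPow θ j ω) s n = blockProduct θ Φ ω (s + j) n := by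
  induction n with
  | zero => rfl
  | succ n ih =>
    rw [blockProduct, blockProduct, ih, ← thetaPow_add]
    congr 3
    ring

theorem isCPTP_blockProduct (hΦ : ∀ ω, IsCPTP (Φ ω)) (ω : Ω) (s : ℤ) (n : ℕ) :
    IsCPTP (blockProduct θ Φ ω s n) := by
  induction n with
  | zero => exact IsCPTP.id
  | succ n ih => exact (hΦ _).comp ih

theorem measurable_thetaPow_natCast (n : ℕ) : Measurable fun ω => thetaPow θ (n : ℤ) ω := by
  simp only [thetaPow_natCast]
  exact θ.measurable.iterate n

theorem measurableSuperOpFamily_blockProduct (hΦ : MeasurableSuperOpFamily Φ) (n : ℕ) :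
    MeasurableSuperOpFamily fun ω => blockProduct θ Φ ω 0 n := by
  induction n with
  | zero => exact fun X i j => measurable_const
  | succ n ih =>
    refine MeasurableSuperOpFamily.comp (fun X i j => ?_) ih
    simp only [zero_add]
    exact (hΦ X i j).comp (measurable_thetaPow_natCast n)

theorem kappaProduct_natCast_zero (ω : Ω) (n : ℕ) :
    kappaProduct θ Φ ω (n : ℤ) 0 = kappaTr (blockProduct θ Φ ω 0 n) := by
  simp [kappaProduct, chronProduct]

/-- The last `n` steps seen from `ω` are the first `n` steps seen from `θ^{-n} ω`. -/
theorem kappaProduct_zero_neg (ω : Ω) (n : ℕ) :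
    kappaProduct θ Φ ω 0 (-(n : ℤ)) = kappaProduct θ Φ (θ.symm^[n] ω) (n : ℤ) 0 := by
  rw [kappaProduct_natCast_zero, ← thetaPow_neg_natCast, blockProduct_thetaPow]
  simp [kappaProduct, chronProduct]

theorem isContractiveCocycle_kappaProduct (hΦ_meas : MeasurableSuperOpFamily Φ)
    (hΦ : ∀ ω, IsCPTP (Φ ω)) :
    IsContractiveCocycle θ fun n ω => kappaProduct θ Φ ω (n : ℤ) 0 where
  measurable n := by
    simp only [kappaProduct_natCast_zero]
    exact (measurableSuperOpFamily_blockProduct hΦ_meas n).measurable_kappaTr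
      fun ω => isCPTP_blockProduct hΦ ω 0 n
  nonneg n ω := kappaTr_nonneg _
  le_one n ω := by
    rw [kappaProduct_natCast_zero]
    exact (isCPTP_blockProduct hΦ ω 0 n).kappaTr_le_one
  add_le n m ω := by
    simp only [kappaProduct_natCast_zero]
    rw [blockProduct_add, ← thetaPow_natCast, blockProduct_thetaPow, mul_comm]
    exact (isCPTP_blockProduct hΦ ω _ m).kappaTr_comp_le (isCPTP_blockProduct hΦ ω 0 n)

theorem normalizedLogKappa_le_iff (ω : Ω) {n : ℕ} (hn : 0 < n) (c : ℝ) :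
    normalizedLogKappa θ Φ ω n ≤ (c : EReal) ↔
      kappaProduct θ Φ ω (n : ℤ) 0 ≤ Real.exp (c * n) :=
  log_ofReal_div_le_iff hn

theorem lambdaTr_le_of_eventually {ω : Ω} {c : ℝ}
    (h : ∀ᶠ n : ℕ in atTop, kappaProduct θ Φ ω (n : ℤ) 0 ≤ Real.exp (c * n)) :
    lambdaTr θ Φ ω ≤ (c : EReal) := by
  refine limsup_le_of_le (by isBoundedDefault) ?_
  filter_upwards [h, eventually_gt_atTop 0] with n hn hn0
  exact (normalizedLogKappa_le_iff ω hn0 c).mpr hn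

theorem eventually_le_exp_of_lambdaTr_lt {ω : Ω} {c : ℝ} (h : lambdaTr θ Φ ω < (c : EReal)) :
    ∀ᶠ n : ℕ in atTop, kappaProduct θ Φ ω (n : ℤ) 0 ≤ Real.exp (c * n) := by
  filter_upwards [eventually_lt_of_limsup_lt h, eventually_gt_atTop 0] with n hn hn0
  exact (normalizedLogKappa_le_iff ω hn0 c).mp hn.le

theorem lambdaTr_nonpos (hΦ : ∀ ω, IsCPTP (Φ ω)) (ω : Ω) : lambdaTr θ Φ ω ≤ 0 := by
  refine lambdaTr_le_of_eventually (c := 0) (Eventually.of_forall fun n => ?_)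
  rw [kappaProduct_natCast_zero, zero_mul, Real.exp_zero]
  exact (isCPTP_blockProduct hΦ ω 0 n).kappaTr_le_one

theorem ae_tendsto_normalizedLogKappa {μ : Measure Ω} [IsProbabilityMeasure μ]
    (hθ : MeasurePreserving θ μ μ) (hΦ_meas : MeasurableSuperOpFamily Φ)
    (hΦ : ∀ ω, IsCPTP (Φ ω)) :
    ∀ᵐ ω ∂μ, Tendsto (normalizedLogKappa θ Φ ω) atTop (𝓝 (lambdaTr θ Φ ω)) := by
  have hκ := isContractiveCocycle_kappaProduct (θ := θ) hΦ_meas hΦ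
  -- Rational rates keep the exceptional set a countable union of null sets.
  have key : ∀ᵐ ω ∂μ, ∀ q q' : ℚ, (q : ℝ) < q' → (q' : ℝ) < 0 →
      (∃ᶠ n : ℕ in atTop, kappaProduct θ Φ ω (n : ℤ) 0 ≤ Real.exp (q * n)) →
      ∀ᶠ n : ℕ in atTop, kappaProduct θ Φ ω (n : ℤ) 0 ≤ Real.exp (q' * n) := by
    refine ae_all_iff.mpr fun q => ae_all_iff.mpr fun q' => ?_
    by_cases h : (q : ℝ) < q' ∧ (q' : ℝ) < 0
    · filter_upwards [hκ.ae_eventually_le_exp hθ h.1 h.2] with ω hω _ _ using hω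
    · exact ae_of_all _ fun ω h1 h2 => (h ⟨h1, h2⟩).elim
  filter_upwards [key] with ω hω
  refine tendsto_of_le_liminf_of_limsup_le ?_ le_rfl
  by_contra! hlt
  obtain ⟨q, hq1, hq2⟩ := EReal.lt_iff_exists_rat_btwn.mp hlt
  obtain ⟨q', hq'1, hq'2⟩ := EReal.lt_iff_exists_rat_btwn.mp hq2
  have hqq' : (q : ℝ) < q' := EReal.coe_lt_coe_iff.mp hq'1
  have hq'0 : (q' : ℝ) < 0 :=
    EReal.coe_lt_coe_iff.mp (hq'2.trans_le (lambdaTr_nonpos hΦ ω))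
  refine not_le_of_gt hq'2 (lambdaTr_le_of_eventually (hω q q' hqq' hq'0 ?_))
  refine ((frequently_lt_of_liminf_lt (by isBoundedDefault) hq1).and_eventually
    (eventually_gt_atTop 0)).mono fun n hn => ?_
  exact (normalizedLogKappa_le_iff ω hn.2 q).mp hn.1.le

end Application

/-! ### Existence of the limit and the three equivalent conditions. -/

theorem mainTheorem5 {Ω : Type*} [MeasurableSpace Ω] (μ : Measure Ω) [IsProbabilityMeasure μ]
    (θ : Ω ≃ᵐ Ω) (hθ : MeasurePreserving θ μ μ)
    (d : ℕ) (Φ : Ω → SuperOp d) (hΦ_meas : MeasurableSuperOpFamily Φ)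
    (hΦ : ∀ ω, IsCPTP (Φ ω)) :
    (∀ᵐ ω ∂μ, lambdaTr θ Φ ω ≤ 0 ∧
      Tendsto (normalizedLogKappa θ Φ ω) atTop (𝓝 (lambdaTr θ Φ ω))) ∧
    List.TFAE [
      ∀ᵐ ω ∂μ, lambdaTr θ Φ ω < 0,
      ∀ᵐ ω ∂μ, Tendsto (fun n : ℕ => kappaProduct θ Φ ω (n : ℤ) 0) atTop (𝓝 0),
      ∀ᵐ ω ∂μ, Tendsto (fun n : ℕ => kappaProduct θ Φ ω 0 (-(n : ℤ))) atTop (𝓝 0)] := by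
  have hκ := isContractiveCocycle_kappaProduct (θ := θ) hΦ_meas hΦ
  refine ⟨?_, ?_⟩
  · filter_upwards [ae_tendsto_normalizedLogKappa hθ hΦ_meas hΦ] with ω hω
    exact ⟨lambdaTr_nonpos hΦ ω, hω⟩
  have hsymm : MeasurePreserving θ.symm μ μ := hθ.symm
  have hback : ∀ n : ℕ, Measurable fun ω => kappaProduct θ Φ ω 0 (-(n : ℤ)) := by
    intro n
    simp only [kappaProduct_zero_neg]
    exact (hκ.measurable n).comp (hsymm.iterate n).measurable
  have hback0 : ∀ (n : ℕ) ω, 0 ≤ kappaProduct θ Φ ω 0 (-(n : ℤ)) := fun _ _ => kappaTr_nonneg _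
  have hback1 : ∀ (n : ℕ) ω, kappaProduct θ Φ ω 0 (-(n : ℤ)) ≤ 1 := by
    intro n ω
    rw [kappaProduct_zero_neg]
    exact hκ.le_one n _
  -- Lengthening the past adds an earliest factor, which is dropped by `succ_le_comp` at `θ^{-(n+1)}
  -- ω`.
  have hanti : ∀ ω, Antitone fun n : ℕ => kappaProduct θ Φ ω 0 (-(n : ℤ)) := by
    refine fun ω => antitone_nat_of_succ_le fun n => ?_
    rw [kappaProduct_zero_neg, kappaProduct_zero_neg, Function.iterate_succ_apply']
    refine (hκ.succ_le_comp n _).trans_eq ?_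
    rw [θ.apply_symm_apply]
  have hint : ∀ n : ℕ, ∫ ω, kappaProduct θ Φ ω (n : ℤ) 0 ∂μ
      = ∫ ω, kappaProduct θ Φ ω 0 (-(n : ℤ)) ∂μ := by
    intro n
    simp only [kappaProduct_zero_neg]
    have := integral_map (hsymm.iterate n).measurable.aemeasurable (μ := μ)
      (f := fun ω => kappaProduct θ Φ ω (n : ℤ) 0) (hκ.measurable n).aestronglyMeasurable
    rwa [(hsymm.iterate n).map_eq] at this
  tfae_have 1 → 2 := by
    intro h
    filter_upwards [h] with ω hω
    obtain ⟨q, hq1, hq2⟩ := EReal.lt_iff_exists_rat_btwn.mp hω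
    have hq0 : (q : ℝ) < 0 := EReal.coe_lt_coe_iff.mp hq2
    refine squeeze_zero' (Eventually.of_forall fun n => hκ.nonneg n ω)
      (eventually_le_exp_of_lambdaTr_lt hq1) ?_
    exact Real.tendsto_exp_atBot.comp
      ((tendsto_natCast_atTop_atTop (R := ℝ)).const_mul_atTop_of_neg hq0)
  tfae_have 2 → 1 := by
    intro h
    filter_upwards [hκ.ae_exists_eventually_le_exp hθ h] with ω hω
    obtain ⟨c, hc, hev⟩ := hω
    exact (lambdaTr_le_of_eventually hev).trans_lt (EReal.coe_lt_coe_iff.mpr hc)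
  tfae_have 2 → 3 := ae_tendsto_zero_of_integral_eq hκ.measurable hback hκ.nonneg hback0
    hκ.le_one hback1 hanti hint
  tfae_have 3 → 2 := ae_tendsto_zero_of_integral_eq hback hκ.measurable hback0 hκ.nonneg
    hback1 hκ.le_one hκ.antitone fun n => (hint n).symm
  tfae_finish
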